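/- **Conventions.** Let $A$ and $B$ be nontrivial commutative groups, written additively. For $f : A \to B$ and $a \in A$ put $(\Delta_a f)(x) = f(x+a) - f(x)$. The functional degree $\operatorname{fdeg}(f) \in \mathbb{N} \cup \{-\infty, \infty\}$ is $-\infty$ if $f = 0$; for $f \ne 0$ it is the least $n \in \mathbb{N}$ such that $\Delta_{a_1} \cdots \Delta_{a_{n+1}} f = 0$ for all $a_1, \dots, a_{n+1} \in A$, and $\infty$ if there is no such $n$. Let $\delta(A,B) = \sup\{\operatorname{fdeg}(f) \mid f : A \to B\}$. For $a \in A$ and $b \in B$ let $\delta_{a,b} : A \to B$ be the delta function with value $b$ at $a$ and $0$ elsewhere. A commutative group is a $p$-group if each of its elements is killed by some power of $p$. Write $Z_n = \mathbb{Z}/n\mathbb{Z}$. For a commutative ring $R$, the augmentation ideal of the group ring $R[A]$ is the kernel of the map $R[A] \to R$, $\sum_a r_a [a] \mapsto \sum_a r_a$; the nilpotency index of an ideal $I$ is the least $n \in \mathbb{N}$ with $I^n = 0$, or $\infty$ if there is none. **Theorem.** Let $A$ and $B$ be nontrivial commutative groups. (a) If $A$ is infinite, then $\operatorname{fdeg}(\delta_{a,b})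 = \infty$ for all $a \in A$ and all $b \in B \setminus \{0\}$; in particular $\delta(A,B) = \infty$. (b) If there is no prime $p$ such that $A$ is a finite $p$-group and $B$ is a $p$-group, then $\operatorname{fdeg}(\delta_{0,b}) = \infty$ for some $b \in B$; in particular $\delta(A,B) = \infty$. (c) If, for some prime $p$, $A \cong \bigoplus_{i=1}^r Z_{p^{\alpha_i}}$ with $\alpha_1 \ge \dots \ge \alpha_r$, and $B$ is a $p$-group of finite exponent $p^\beta$, then $$\delta(A,B) = \sum_{j=1}^r (p^{\alpha_j} - 1) + (\beta - 1)(p-1)p^{\alpha_1 - 1},$$ and the nilpotency index of the augmentation ideal of $Z_{p^\beta}[A]$ is $$\sum_{j=1}^r (p^{\alpha_j} - 1) + (\beta - 1)(p-1)p^{\alpha_1 - 1} + 1.$$ (d) If, for some prime $p$, $A$ is a finite $p$-group and $B$ is a $p$-group of infinite exponent, then every $f : A \to B$ satisfies $\operatorname{fdeg}(f) < \infty$, but $\delta(A,B) = \infty$. -/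

import Mathlib

namespace FunctionalDegree

/-- The commutative group `G` is a `p`-group: every element is killed by a power of `p`. -/
def IsPrimary (p : ℕ) (G : Type*) [AddCommGroup G] : Prop :=
  ∀ x : G, ∃ k : ℕ, p ^ k • x = 0

/-- The condition `Δ_{a₁} ⋯ Δ_{aₙ₊₁} f = 0` for all `a₁, …, aₙ₊₁ ∈ A`, where
`(Δ_a f)(x) = f (x + a) - f x` is Mathlib's forward difference `fwdDiff a f`. -/
def DegLE {A B : Type*} [AddCommGroup A] [AddCommGroup B] (f : A → B) (n : ℕ) : Prop :=
  ∀ l : List A, l.length = n + 1 → l.foldr fwdDiff f = 0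

open Classical in
/-- The functional degree of `f`, a value in `ℕ ∪ {-∞, ∞}`: it is `-∞ = ⊥` for `f = 0`, and for
`f ≠ 0` the least `n` with `DegLE f n`, or `∞ = ⊤` if there is no such `n` (an infimum over the
empty set in `ℕ∞` is `⊤`). -/
noncomputable def fdeg {A B : Type*} [AddCommGroup A] [AddCommGroup B] (f : A → B) :
    WithBot ℕ∞ :=
  if f = 0 then ⊥ else ((⨅ (n : ℕ) (_ : DegLE f n), (n : ℕ∞) : ℕ∞) : WithBot ℕ∞)

/-- `δ(A, B)`: the supremum of the functional degrees of all maps `A → B`. -/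
noncomputable def delta (A B : Type*) [AddCommGroup A] [AddCommGroup B] : WithBot ℕ∞ :=
  ⨆ f : A → B, fdeg f

open Classical in
/-- The delta function `δ_{a,b}`, with value `b` at `a` and `0` elsewhere. -/
noncomputable def deltaFun {A B : Type*} [AddCommGroup A] [AddCommGroup B] (a : A) (b : B) :
    A → B :=
  fun x => if x = a then b else 0

/-- The augmentation map `R[A] → R`, sending every group element to `1`. -/
noncomputable def augmentation (R A : Type*) [CommRing R] [AddCommGroup A] :
    AddMonoidAlgebra R A →ₐ[R] R :=
  AddMonoidAlgebra.lift R R A 1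

/-- The augmentation map sends a formal linear combination to the sum of its coefficients. -/
theorem augmentation_single (R A : Type*) [CommRing R] [AddCommGroup A] (a : A) (r : R) :
    augmentation R A (AddMonoidAlgebra.single a r) = r := by
  simp [augmentation]

/-- The augmentation ideal of the group ring `R[A]`. -/
noncomputable def augmentationIdeal (R A : Type*) [CommRing R] [AddCommGroup A] :
    Ideal (AddMonoidAlgebra R A) :=
  RingHom.ker (augmentation R A)

/-- The nilpotency index of an ideal: the least `n` with `I ^ n = 0`, or `∞` if there is none. -/
noncomputable def nilpotencyIndex {R : Type*} [CommRing R] (I : Ideal R) : ℕ∞ :=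
  ⨅ (n : ℕ) (_ : I ^ n = ⊥), (n : ℕ∞)

end FunctionalDegree

/-! In the group ring, `[a] - 1` acts on functions as `Δ_a`, so functional degrees are governed by
the powers of the augmentation ideal `I`. Write `q = p^α₁`, `w = (p-1)p^(α₁-1)` and `S = ∑ (p^αⱼ -
1)`.

Upper bound: give `p` the weight `w`. For a generator `T` of order dividing `p^a`, expanding `1 = (1
+ (T-1))^(p^a)` writes `(T-1)^(p^a)` as `p` times terms of weight at least `p^a - w`. By pigeonhole
every monomial of degree above `S` contains such a power. So a factor `p` can be bought repeatedly
for `w` units of weight, and `I^(S+(β-1)w+1) ⊆ (p^β)` (`span_sub_one_pow_le`).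

Sharpness: `(X-1)^(q-1+(β-1)w)` is not in `(p^β, X^q-1)` (`X_sub_one_pow_notMem`), by induction on
`β`, comparing `(X-1)^w` with the cyclotomic polynomial `Φ_q`. The resulting nonzero difference on
the largest cyclic summand is multiplied by delta functions on the others.

Infinite degrees: on an infinite group, a nonzero function of finite support always has a nonzero
difference of finite support. If `m • a = 0`, then `Δ_a^(n+1) f = 0` forces `m^n • Δ_a f = 0`
(`pow_smul_fwdDiff_eq_zero`); this rules out mixed primes and makes `δ(A,B)` infinite when the
exponent is unbounded. -/

namespace FunctionalDegree

/-! ### Trading powers of an ideal for powers of `p` -/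

/-- The filtration of a commutative ring in which `π` has weight `w` and elements of `I` have
weight `1`. -/
def weightIdeal {R : Type*} [CommRing R] (π : R) (w : ℕ) (I : Ideal R) (d : ℕ) : Ideal R :=
  ⨆ k : ℕ, Ideal.span {π} ^ k * I ^ (d - k * w)

section Weight

variable {R : Type*} [CommRing R] (π : R) (w : ℕ) (I : Ideal R)

/-- Truncated subtraction turns the `k`-th summand into all of `(π^k)` once `d ≤ k * w`, so excess
weight does no harm. -/
theorem pow_mul_pow_le_weightIdeal {d k i : ℕ} (h : d ≤ i + k * w) :
    Ideal.span {π} ^ k * I ^ i ≤ weightIdeal π w I d :=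
  (Ideal.mul_mono_right (Ideal.pow_le_pow_right (by omega))).trans
    (le_iSup (fun k : ℕ => Ideal.span {π} ^ k * I ^ (d - k * w)) k)

theorem pow_le_weightIdeal (d : ℕ) : I ^ d ≤ weightIdeal π w I d := by
  simpa using pow_mul_pow_le_weightIdeal π w I (k := 0) (i := d) (d := d) (by simp)

theorem weightIdeal_mul_pow_le {d e n : ℕ} (h : n ≤ d + e) :
    weightIdeal π w I d * I ^ e ≤ weightIdeal π w I n := by
  rw [weightIdeal, Ideal.iSup_mul]
  refine iSup_le fun k => ?_
  rw [mul_assoc, ← pow_add]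
  exact pow_mul_pow_le_weightIdeal π w I (by omega)

/-- If high powers of `I` can be traded for a factor `π`, then so can high steps of the
filtration. -/
theorem weightIdeal_le_span_mul {m : ℕ}
    (h : I ^ m ≤ Ideal.span {π} * weightIdeal π w I (m - w)) :
    weightIdeal π w I m ≤ Ideal.span {π} * weightIdeal π w I (m - w) := by
  refine iSup_le fun k => ?_
  cases k with
  | zero => simpa using h
  | succ k =>
    rw [pow_succ', mul_assoc]
    exact Ideal.mul_mono_right (pow_mul_pow_le_weightIdeal π w I (by
      rw [Nat.add_mul]; omega))

/-- Each trade yields one `π` and lowers the weight by `w`. Starting from `S + b * w + 1`, the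
weight still exceeds `S` after `b` trades, which leaves room for one more. -/
theorem pow_le_span_pow_of_trade {S : ℕ}
    (h : ∀ m, S < m → I ^ m ≤ Ideal.span {π} * weightIdeal π w I (m - w)) (b : ℕ) :
    I ^ (S + b * w + 1) ≤ Ideal.span {π} ^ (b + 1) := by
  refine (pow_le_weightIdeal π w I _).trans ?_
  induction b with
  | zero =>
    refine (weightIdeal_le_span_mul π w I (h _ (by omega))).trans ?_
    rw [zero_add, pow_one]
    exact Ideal.mul_le_left
  | succ b ih =>
    refine (weightIdeal_le_span_mul π w I (h _ (by omega))).trans ?_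
    rw [pow_succ' _ (b + 1)]
    refine Ideal.mul_mono_right ?_
    convert ih using 2
    rw [Nat.add_mul]; omega

end Weight

/-- The witness is the `p`-adic valuation of the binomial coefficient, which equals `α - v_p(i)`. -/
theorem prime_pow_dvd_choose {p α i : ℕ} (hp : p.Prime) (hi : i ≠ 0) (hi' : i < p ^ α) :
    ∃ k, 1 ≤ k ∧ k ≤ α ∧ p ^ (α - k) ≤ i ∧ p ^ k ∣ (p ^ α).choose i := by
  have h := Nat.factorization_choose_prime_pow_add_factorization hp hi'.le hi
  have h1 : p ^ i.factorization p ≤ i := Nat.ordProj_le p hi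
  have h2 : i.factorization p < α :=
    (Nat.pow_lt_pow_iff_right hp.one_lt).1 (h1.trans_lt hi')
  refine ⟨((p ^ α).choose i).factorization p, by omega, by omega, ?_, Nat.ordProj_dvd _ _⟩
  rwa [show α - ((p ^ α).choose i).factorization p = i.factorization p by omega]

/-- `p^a - p^(a-k)` telescopes into `k` differences `(p-1)p^(a-s)`, each at most `w`. This is what
dictates the weight `w`. -/
theorem prime_pow_le_add_mul {p : ℕ} (hp : 1 ≤ p) {a α k : ℕ} (hk : k ≤ a) (h : a ≤ α) :
    p ^ a ≤ p ^ (a - k) + k * ((p - 1) * p ^ (α - 1)) := by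
  induction k with
  | zero => simp
  | succ k ih =>
    have h1 : p ^ (a - k) = p ^ (a - (k + 1)) + (p - 1) * p ^ (a - (k + 1)) := by
      rw [show a - k = a - (k + 1) + 1 by omega, pow_succ]
      obtain ⟨q, rfl⟩ : ∃ q, p = q + 1 := ⟨p - 1, by omega⟩
      simp; ring
    have h2 : (p - 1) * p ^ (a - (k + 1)) ≤ (p - 1) * p ^ (α - 1) :=
      Nat.mul_le_mul_left _ (Nat.pow_le_pow_right hp (by omega))
    have := ih (by omega)
    rw [Nat.add_mul]; omega

/-- The `p ^ a`-th power of the augmentation of an element of order dividing `p ^ a`. -/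
theorem sub_one_pow_mem {R : Type*} [CommRing R] {p a α : ℕ} (hp : p.Prime) (ha : a ≤ α)
    {I : Ideal R} {T : R} (hT : T ^ p ^ a = 1) (hI : T - 1 ∈ I) :
    (T - 1) ^ p ^ a ∈ Ideal.span {(p : R)} *
      weightIdeal (p : R) ((p - 1) * p ^ (α - 1)) I (p ^ a - (p - 1) * p ^ (α - 1)) := by
  have hq : 0 < p ^ a := pow_pos hp.pos _
  have key : (T - 1) ^ p ^ a =
      -∑ i ∈ (Finset.range (p ^ a)).erase 0, (T - 1) ^ i * ((p ^ a).choose i : R) := by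
    have h := add_pow (T - 1) 1 (p ^ a)
    rw [sub_add_cancel, hT, Finset.sum_range_succ,
      ← Finset.add_sum_erase _ _ (Finset.mem_range.2 hq)] at h
    simp only [one_pow, mul_one, pow_zero, Nat.choose_zero_right, Nat.cast_one,
      Nat.choose_self] at h
    linear_combination -h
  rw [key]
  refine neg_mem (Ideal.sum_mem _ fun i hi => ?_)
  rw [Finset.mem_erase, Finset.mem_range] at hi
  obtain ⟨k, hk1, hka, hki, c, hc⟩ := prime_pow_dvd_choose hp hi.1 hi.2
  rw [hc]
  -- One factor `p` of the binomial coefficient is pulled out; the remaining ones count towards the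
  -- weight.
  obtain ⟨k, rfl⟩ : ∃ k', k = k' + 1 := ⟨k - 1, by omega⟩
  have h1 := prime_pow_le_add_mul hp.one_le hka ha
  have : (T - 1) ^ i * ((p ^ (k + 1) * c : ℕ) : R) = p * ((p ^ k * (T - 1) ^ i) * c) := by
    push_cast; ring
  rw [this]
  refine Ideal.mul_mem_mul (Ideal.mem_span_singleton_self _) (Ideal.mul_mem_right _ _
    (pow_mul_pow_le_weightIdeal _ _ I (k := k) (i := i) ?_
      (Ideal.mul_mem_mul (Ideal.pow_mem_pow (Ideal.mem_span_singleton_self _) _)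
        (Ideal.pow_mem_pow hI _))))
  rw [Nat.add_mul] at h1
  omega

theorem prod_pow_mem_pow_sum {R ι : Type*} [CommRing R] {I : Ideal R} (s : Finset ι) (t : ι → R)
    (ht : ∀ i ∈ s, t i ∈ I) (m : ι → ℕ) : ∏ i ∈ s, t i ^ m i ∈ I ^ ∑ i ∈ s, m i := by
  rw [← Finset.prod_pow_eq_pow_sum]
  exact Ideal.prod_mem_prod fun i hi => Ideal.pow_mem_pow (ht i hi) _

open scoped Pointwise in
/-- Powers of the ideal generated by the `T j - 1`, for commuting `p`-power roots of unity `T j`,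
are divisible by high powers of `p`. -/
theorem span_sub_one_pow_le {R ι : Type*} [CommRing R] [Fintype ι] {p α : ℕ} (hp : p.Prime)
    (a : ι → ℕ) (ha : ∀ j, a j ≤ α) (T : ι → R) (hT : ∀ j, T j ^ p ^ a j = 1) (b : ℕ) :
    Ideal.span (Set.range fun j => T j - 1) ^
        ((∑ j, (p ^ a j - 1)) + b * ((p - 1) * p ^ (α - 1)) + 1) ≤
      Ideal.span {(p : R)} ^ (b + 1) := by
  classical
  set I := Ideal.span (Set.range fun j => T j - 1) with hI
  have hmem : ∀ j, T j - 1 ∈ I := fun j => Ideal.subset_span ⟨j, rfl⟩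
  refine pow_le_span_pow_of_trade _ _ _ (fun m hm => ?_) b
  have hspan : I ^ m = Ideal.span ((Set.range fun j => T j - 1) ^ m) := Submodule.span_pow _ m
  rw [hspan, Ideal.span_le]
  intro x hx
  obtain ⟨f, rfl⟩ := Set.mem_pow.1 hx
  have hf : ∀ i, ∃ j, T j - 1 = (f i : R) := fun i => (f i).2
  choose g hg using hf
  -- `c j` is the exponent of `T j - 1` in the monomial.
  set c : ι → ℕ := fun j => (Finset.univ.filter fun i => g i = j).card
  have hprod : (List.ofFn fun i => (f i : R)).prod = ∏ j, (T j - 1) ^ c j := by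
    rw [List.prod_ofFn, ← Finset.prod_fiberwise (s := Finset.univ) (g := g)]
    refine Finset.prod_congr rfl fun j _ => ?_
    rw [Finset.prod_congr rfl (g := fun _ => T j - 1), Finset.prod_const]
    intro i hi
    rw [← hg, (Finset.mem_filter.1 hi).2]
  have hsum : ∑ j, c j = m := by
    have := Finset.card_eq_sum_card_fiberwise (s := Finset.univ) (t := Finset.univ) (f := g)
      (fun _ _ => by simp)
    rw [← this]
    simp
  -- Pigeonhole: the total degree `m` exceeds `∑ (p ^ a j - 1)`.
  obtain ⟨j, hj⟩ : ∃ j, p ^ a j ≤ c j := by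
    by_contra! h
    have : ∑ j, c j ≤ ∑ j, (p ^ a j - 1) := Finset.sum_le_sum fun j _ => by
      have := h j; omega
    omega
  rw [SetLike.mem_coe, hprod, ← Finset.mul_prod_erase _ _ (Finset.mem_univ j)]
  have hrest := prod_pow_mem_pow_sum (I := I) (Finset.univ.erase j) (fun j => T j - 1)
    (fun j _ => hmem j) c
  have hsum' := Finset.add_sum_erase Finset.univ c (Finset.mem_univ j)
  rw [show (T j - 1) ^ c j = (T j - 1) ^ p ^ a j * (T j - 1) ^ (c j - p ^ a j) by
    rw [← pow_add]; congr 1; omega, mul_assoc]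
  refine Ideal.mul_mono_right (weightIdeal_mul_pow_le (p : R) _ I
    (d := p ^ a j - (p - 1) * p ^ (α - 1))
    (e := (c j - p ^ a j) + ∑ i ∈ Finset.univ.erase j, c i) ?_) ?_
  · omega
  · rw [← mul_assoc]
    refine Ideal.mul_mem_mul (sub_one_pow_mem hp (ha j) (hT j) (hmem j)) ?_
    rw [pow_add]
    exact Ideal.mul_mem_mul (Ideal.pow_mem_pow (hmem j) _) hrest

end FunctionalDegree

namespace FunctionalDegree

/-! ### Sharpness for a cyclic group, in `ℤ[X]` -/

open Polynomial

theorem X_sub_one_pow_mem {p α β n : ℕ} (hp : p.Prime)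
    (hn : p ^ α + β * ((p - 1) * p ^ (α - 1)) ≤ n) :
    ((X - 1) ^ n : ℤ[X]) ∈ Ideal.span {(p : ℤ[X]) ^ (β + 1), X ^ p ^ α - 1} := by
  set J : Ideal ℤ[X] := Ideal.span {(p : ℤ[X]) ^ (β + 1), X ^ p ^ α - 1} with hJ
  have hpos : 0 < p ^ α := pow_pos hp.pos _
  have hT : (Ideal.Quotient.mk J X) ^ p ^ α = 1 := by
    rw [← map_pow, ← map_one (Ideal.Quotient.mk J), Ideal.Quotient.eq]
    exact Ideal.subset_span (by simp)
  have h := span_sub_one_pow_le hp (fun _ : Unit => α) (fun _ => le_rfl)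
    (fun _ => Ideal.Quotient.mk J X) (fun _ => hT) β
  have h0 : ((p : ℤ[X] ⧸ J)) ^ (β + 1) = 0 := by
    have : Ideal.Quotient.mk J ((p : ℤ[X]) ^ (β + 1)) = 0 :=
      Ideal.Quotient.eq_zero_iff_mem.2 (Ideal.subset_span (by simp))
    simpa using this
  rw [Ideal.span_singleton_pow, h0, Ideal.span_singleton_eq_bot.2 rfl, le_bot_iff] at h
  have hmem : (Ideal.Quotient.mk J X - 1) ^ (p ^ α + β * ((p - 1) * p ^ (α - 1))) = 0 := by
    rw [← Ideal.mem_bot, ← h]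
    have hx : Ideal.Quotient.mk J X - 1 ∈
        Ideal.span (Set.range fun _ : Unit => Ideal.Quotient.mk J X - 1) :=
      Ideal.subset_span ⟨(), rfl⟩
    convert Ideal.pow_mem_pow hx _ using 2
    simp
    omega
  rw [← Ideal.Quotient.eq_zero_iff_mem]
  simpa using pow_eq_zero_of_le hn hmem

/-- The prime `p` does not divide a monic `g`, so it is a nonzerodivisor modulo `g` and can be
cancelled. -/
theorem mem_span_of_mul_mem {p β : ℕ} (hp : p.Prime) {g x : ℤ[X]} (hg : g.Monic)
    (h : (p : ℤ[X]) * x ∈ Ideal.span {(p : ℤ[X]) ^ (β + 1), g}) :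
    x ∈ Ideal.span {(p : ℤ[X]) ^ β, g} := by
  have hpp : Prime (p : ℤ[X]) := by
    have := Polynomial.prime_C_iff.2 (Nat.prime_iff_prime_int.1 hp)
    simpa using this
  rw [Ideal.mem_span_pair] at h ⊢
  obtain ⟨a, b, hab⟩ := h
  have hdvd : (p : ℤ[X]) ∣ b * g := ⟨x - a * p ^ β, by rw [mul_sub, ← hab]; ring⟩
  rcases hpp.dvd_or_dvd hdvd with ⟨c, rfl⟩ | hd
  · refine ⟨a, c, mul_left_cancel₀ hpp.ne_zero ?_⟩
    rw [← hab]; ring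
  · exfalso
    have h1 : (C (p : ℤ)) ∣ g := by simpa using hd
    have h2 := (Polynomial.C_dvd_iff_dvd_coeff _ _).1 h1 g.natDegree
    rw [hg.coeff_natDegree] at h2
    exact (Nat.prime_iff_prime_int.1 hp).not_dvd_one h2

theorem X_pow_sub_one_monic {n : ℕ} (hn : n ≠ 0) : (X ^ n - 1 : ℤ[X]).Monic :=
  monic_X_pow_sub_C 1 hn

/-- Comparison of a power of `X - 1` with a cyclotomic polynomial modulo `p`. -/
theorem exists_cyclotomic_eq {p : ℕ} (hp : p.Prime) (α : ℕ) :
    ∃ u : ℤ[X], (X - 1) ^ ((p - 1) * p ^ α) =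
      cyclotomic (p ^ (α + 1)) ℤ - (p : ℤ[X]) + (p : ℤ[X]) * ((X - 1) * u) := by
  have := Fact.mk hp
  set w := (p - 1) * p ^ α with hw
  have hwpos : w ≠ 0 := Nat.mul_ne_zero (by have := hp.two_le; omega) (pow_pos hp.pos _).ne'
  have h1 : (C (p : ℤ)) ∣ ((X - 1) ^ w - cyclotomic (p ^ (α + 1)) ℤ : ℤ[X]) := by
    rw [Polynomial.C_dvd_iff_dvd_coeff]
    intro i
    rw [← ZMod.intCast_zmod_eq_zero_iff_dvd, ← eq_intCast (Int.castRingHom (ZMod p)),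
      ← Polynomial.coeff_map]
    have h2 := cyclotomic_mul_prime_pow_eq (ZMod p) (p := p) (m := 1) (k := α + 1)
      hp.not_dvd_one (by omega)
    rw [mul_one, cyclotomic_one] at h2
    have h3 : p ^ (α + 1) - p ^ (α + 1 - 1) = w := by
      rw [hw, Nat.sub_mul, pow_succ']; simp
    rw [h3] at h2
    simp [h2]
  obtain ⟨h, hh⟩ := h1
  -- At `X = 1` the power vanishes and the cyclotomic polynomial takes the value `p`, so `h(1) =
  -- -1`.
  have h4 : (X - 1 : ℤ[X]) ∣ h + 1 := by
    rw [← C_1, Polynomial.dvd_iff_isRoot, IsRoot.def]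
    have := congrArg (eval 1) hh
    rw [eval_sub, eval_one_cyclotomic_prime_pow] at this
    simp [hwpos] at this
    have hp0 : (p : ℤ) ≠ 0 := by exact_mod_cast hp.ne_zero
    have h5 : (p : ℤ) * (eval 1 h + 1) = 0 := by linarith
    rw [eval_add, eval_C]
    exact (mul_eq_zero.1 h5).resolve_left hp0
  obtain ⟨u, hu⟩ := h4
  refine ⟨u, ?_⟩
  rw [← hu]
  have : (C (p : ℤ) : ℤ[X]) = p := by simp
  rw [this] at hh
  linear_combination hh

/-- The powers of `X - 1` in `X_sub_one_pow_mem` cannot be lowered. -/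
theorem X_sub_one_pow_notMem {p α : ℕ} (hp : p.Prime) (β : ℕ) :
    ((X - 1) ^ (p ^ (α + 1) - 1 + β * ((p - 1) * p ^ α)) : ℤ[X]) ∉
      Ideal.span {(p : ℤ[X]) ^ (β + 1), X ^ p ^ (α + 1) - 1} := by
  have := Fact.mk hp
  have hq : 0 < p ^ (α + 1) := pow_pos hp.pos _
  have hq' : 0 < p ^ α := pow_pos hp.pos _
  have hqq : (p - 1) * p ^ α + p ^ α = p ^ (α + 1) := by
    rw [Nat.sub_mul, pow_succ']
    have := Nat.le_mul_of_pos_left (p ^ α) hp.pos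
    omega
  induction β with
  | zero =>
    intro h
    rw [Ideal.mem_span_pair] at h
    obtain ⟨a, b, hab⟩ := h
    have h1 := congrArg (Polynomial.map (Int.castRingHom (ZMod p))) hab
    have h2 : (X ^ p ^ (α + 1) - 1 : (ZMod p)[X]) ∣ (X - 1) ^ (p ^ (α + 1) - 1) :=
      ⟨b.map (Int.castRingHom (ZMod p)), by simpa [mul_comm] using h1.symm⟩
    -- Modulo `p`, a polynomial of degree `p^(α+1)` would divide one of degree `p^(α+1) - 1`.
    have h3 := Polynomial.natDegree_le_of_dvd h2
      (pow_ne_zero _ (by simpa using X_sub_C_ne_zero (1 : ZMod p)))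
    rw [← C_1, natDegree_X_pow_sub_C, natDegree_pow, natDegree_X_sub_C] at h3
    omega
  | succ β ih =>
    intro h
    obtain ⟨u, hu⟩ := exists_cyclotomic_eq hp α
    set w := (p - 1) * p ^ α with hw
    set M := p ^ (α + 1) - 1 + β * w with hM
    set J : Ideal ℤ[X] := Ideal.span {(p : ℤ[X]) ^ (β + 1 + 1), X ^ p ^ (α + 1) - 1} with hJ
    -- For the smaller modulus `X^(p^α) - 1` the exponent `M` already suffices to reach `p^(β+2)`;
    -- multiplying by the cyclotomic polynomial restores `X^(p^(α+1)) - 1`.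
    have e1 : ((X - 1) ^ M * cyclotomic (p ^ (α + 1)) ℤ : ℤ[X]) ∈ J := by
      have h1 : ((X - 1) ^ M : ℤ[X]) ∈
          Ideal.span {(p : ℤ[X]) ^ (β + 1 + 1), X ^ p ^ α - 1} := by
        cases α with
        | zero =>
          rw [Ideal.mem_span_pair]
          have : M = (M - 1) + 1 := by
            have := hp.two_le
            simp only [zero_add, pow_one] at hM
            omega
          refine ⟨0, (X - 1) ^ (M - 1), ?_⟩
          rw [this]; simp [pow_succ]
        | succ α =>
          refine X_sub_one_pow_mem hp ?_
          have hle : 1 ≤ p ^ α := pow_pos hp.pos _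
          have h2 : w = p * ((p - 1) * p ^ α) := by rw [hw, pow_succ]; ring
          simp only [Nat.add_sub_cancel]
          have h3 : 1 ≤ (p - 1) * p ^ α :=
            Nat.mul_pos (by have := hp.two_le; omega) hle
          -- A trade for the smaller modulus costs only `w / p ≤ w / 2`.
          have h4 : 2 * ((p - 1) * p ^ α) ≤ w := by
            rw [h2]; exact Nat.mul_le_mul_right _ hp.two_le
          have h5 : (β + 1) * (2 * ((p - 1) * p ^ α)) ≤ (β + 1) * w :=
            Nat.mul_le_mul_left _ h4
          have h6 : 1 ≤ (β + 1) * ((p - 1) * p ^ α) := Nat.mul_pos (by omega) h3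
          have h7 : (β + 1) * w = β * w + w := by ring
          have h8 : (β + 1) * (2 * ((p - 1) * p ^ α)) = 2 * ((β + 1) * ((p - 1) * p ^ α)) := by
            ring
          omega
      rw [Ideal.mem_span_pair] at h1 ⊢
      obtain ⟨a, b, hab⟩ := h1
      refine ⟨a * cyclotomic (p ^ (α + 1)) ℤ, b, ?_⟩
      rw [← hab, ← cyclotomic_prime_pow_mul_X_pow_sub_one]
      ring
    have e2 : ((p : ℤ[X]) * (X - 1) ^ (M + 1)) ∈ J := by
      have h1 : ((X - 1) ^ (M + 1) : ℤ[X]) ∈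
          Ideal.span {(p : ℤ[X]) ^ (β + 1), X ^ p ^ (α + 1) - 1} :=
        X_sub_one_pow_mem hp (by rw [Nat.add_sub_cancel, ← hw]; omega)
      rw [Ideal.mem_span_pair] at h1 ⊢
      obtain ⟨a, b, hab⟩ := h1
      refine ⟨a, p * b, ?_⟩
      rw [← hab]
      ring
    refine ih (mem_span_of_mul_mem hp (X_pow_sub_one_monic hq.ne') ?_)
    have e3 : p ^ (α + 1) - 1 + (β + 1) * w = M + w := by rw [hM]; ring
    rw [e3] at h
    -- If `(X-1)^(M+w)` were in `J`, so would be `p * (X-1)^M`; cancelling `p` contradicts the case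
    -- `β`.
    have e4 : (p : ℤ[X]) * (X - 1) ^ M = (X - 1) ^ M * cyclotomic (p ^ (α + 1)) ℤ
        + (p : ℤ[X]) * (X - 1) ^ (M + 1) * u - (X - 1) ^ (M + w) := by
      rw [pow_add _ M w, hu]; ring
    rw [e4]
    exact J.sub_mem (J.add_mem e1 (J.mul_mem_right _ e2)) h

/-- An iterated difference of the delta function on a cyclic group whose value is not divisible by
`p ^ (β + 1)`. -/
theorem exists_not_dvd_fwdDiff_iter {p α : ℕ} (hp : p.Prime) (β : ℕ) :
    ∃ y : ZMod (p ^ (α + 1)), ¬ ((p : ℤ) ^ (β + 1) ∣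
      (fwdDiff (1 : ZMod (p ^ (α + 1))))^[p ^ (α + 1) - 1 + β * ((p - 1) * p ^ α)]
        (deltaFun (0 : ZMod (p ^ (α + 1))) (1 : ℤ)) y) := by
  by_contra! H
  refine X_sub_one_pow_notMem (α := α) hp β ?_
  set n := p ^ (α + 1) - 1 + β * ((p - 1) * p ^ α)
  set q := p ^ (α + 1)
  set J : Ideal ℤ[X] := Ideal.span {(p : ℤ[X]) ^ (β + 1), X ^ q - 1} with hJ
  have hq : 0 < q := pow_pos hp.pos _
  have : NeZero q := ⟨hq.ne'⟩
  set c : ℕ → ℤ := fun k => (-1) ^ (n - k) * n.choose k with hc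
  have hX : ∀ k : ℕ, Ideal.Quotient.mk J (X ^ k) =
      Ideal.Quotient.mk J (X ^ (k : ZMod q).val) := by
    intro k
    have hT : (Ideal.Quotient.mk J X) ^ q = 1 := by
      rw [← map_pow, ← map_one (Ideal.Quotient.mk J), Ideal.Quotient.eq]
      exact Ideal.subset_span (by simp)
    rw [ZMod.val_natCast, map_pow, map_pow]
    conv_lhs => rw [← Nat.mod_add_div k q, pow_add, pow_mul, hT, one_pow, mul_one]
  have hexp : ((X - 1) ^ n : ℤ[X]) = ∑ k ∈ Finset.range (n + 1), (c k : ℤ[X]) * X ^ k := by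
    rw [sub_eq_add_neg, add_pow]
    refine Finset.sum_congr rfl fun k _ => ?_
    simp [hc]; ring
  have hval : ∀ y : ZMod q, ((p : ℤ) ^ (β + 1) ∣
      ∑ k ∈ Finset.range (n + 1) with ((k : ℕ) : ZMod q) = y, c k) := by
    intro y
    -- The value at `-y` collects the coefficients of `(X-1)^n` at exponents congruent to `y`, that
    -- is, a coefficient of the reduction modulo `X^q - 1`.
    have := H (-y)
    rw [fwdDiff_iter_eq_sum_shift] at this
    rw [Finset.sum_filter]
    convert this using 2 with k
    simp only [deltaFun, smul_eq_mul, mul_ite, mul_one, mul_zero, nsmul_eq_mul, hc]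
    congr 1
    rw [eq_iff_iff, neg_add_eq_zero, eq_comm]
  rw [← Ideal.Quotient.eq_zero_iff_mem, hexp, map_sum,
    ← Finset.sum_fiberwise (g := fun k : ℕ => (k : ZMod q))]
  refine Finset.sum_eq_zero fun y _ => ?_
  have : ∑ k ∈ Finset.range (n + 1) with ((k : ℕ) : ZMod q) = y,
      Ideal.Quotient.mk J ((c k : ℤ[X]) * X ^ k) =
      Ideal.Quotient.mk J
        (((∑ k ∈ Finset.range (n + 1) with ((k : ℕ) : ZMod q) = y, c k : ℤ) : ℤ[X])
          * X ^ y.val) := by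
    rw [map_mul, Int.cast_sum, map_sum, Finset.sum_mul]
    refine Finset.sum_congr rfl fun k hk => ?_
    rw [map_mul, hX, (Finset.mem_filter.1 hk).2]
  rw [this, Ideal.Quotient.eq_zero_iff_mem]
  obtain ⟨d, hd⟩ := hval y
  rw [hd]
  push_cast
  rw [mul_assoc]
  exact J.mul_mem_right _ (Ideal.subset_span (by simp))

end FunctionalDegree

namespace FunctionalDegree

/-! ### Functional degree, and delta functions of infinite degree -/

section Degree

variable {A B : Type*} [AddCommGroup A] [AddCommGroup B]

theorem fwdDiff_zero_fun (a : A) : fwdDiff a (0 : A → B) = 0 := by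
  funext x; simp [fwdDiff]

theorem DegLE.succ {f : A → B} {n : ℕ} (h : DegLE f n) : DegLE f (n + 1) := by
  rintro (_ | ⟨a, l⟩) hl
  · simp at hl
  · rw [List.foldr_cons, h l (by simpa using hl), fwdDiff_zero_fun]

theorem DegLE.mono {f : A → B} {m n : ℕ} (hmn : m ≤ n) (h : DegLE f m) : DegLE f n := by
  induction hmn with
  | refl => exact h
  | step _ ih => exact ih.succ

theorem fdeg_le_of_degLE {f : A → B} {n : ℕ} (h : DegLE f n) :
    fdeg f ≤ (n : WithBot ℕ∞) := by
  unfold fdeg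
  split_ifs
  · exact bot_le
  · exact WithBot.coe_le_coe.2 (iInf₂_le n h)

theorem length_le_fdeg {f : A → B} {l : List A} (hl : l.foldr fwdDiff f ≠ 0) :
    (l.length : WithBot ℕ∞) ≤ fdeg f := by
  have hf : f ≠ 0 := by
    rintro rfl
    refine hl ?_
    clear hl
    induction l with
    | nil => rfl
    | cons a l ih => rw [List.foldr_cons, ih, fwdDiff_zero_fun]
  rw [fdeg, if_neg hf]
  refine WithBot.coe_le_coe.2 (le_iInf₂ fun n hn => ?_)
  rw [Nat.cast_le]
  by_contra! hlt
  exact hl (DegLE.mono (n := l.length - 1) (by omega) hn l (by omega))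

theorem eq_top_of_forall_natCast_le {x : WithBot ℕ∞} (h : ∀ n : ℕ, (n : WithBot ℕ∞) ≤ x) :
    x = ⊤ := by
  induction x with
  | bot => exact absurd (h 0) (by simp)
  | coe x =>
    have : x = ⊤ := ENat.eq_top_iff_forall_ge.2 fun n => WithBot.coe_le_coe.1 (h n)
    rw [this]; rfl

theorem fdeg_eq_top {f : A → B} (hf : f ≠ 0) (h : ∀ n, ¬ DegLE f n) : fdeg f = ⊤ := by
  simp [fdeg, hf, h]

theorem fdeg_lt_top_of_degLE {f : A → B} {n : ℕ} (h : DegLE f n) : fdeg f < ⊤ :=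
  (fdeg_le_of_degLE h).trans_lt (WithBot.coe_lt_coe.2 (ENat.natCast_lt_top n))

theorem delta_eq_top {f : A → B} (hf : fdeg f = ⊤) : delta A B = ⊤ :=
  top_le_iff.1 (hf ▸ le_iSup (fun f : A → B => fdeg f) f)

theorem deltaFun_self (a : A) (b : B) : deltaFun a b a = b := by simp [deltaFun]

theorem deltaFun_of_ne {a x : A} (h : x ≠ a) (b : B) : deltaFun a b x = 0 := by
  simp [deltaFun, h]

/-- On an infinite group, a nonzero function of finite support has a nonzero difference of finite
support. -/
theorem exists_fwdDiff_ne_zero [Infinite A] {g : A → B} (hfin : g.support.Finite) (hg : g ≠ 0) :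
    ∃ a, fwdDiff a g ≠ 0 ∧ (fwdDiff a g).support.Finite := by
  obtain ⟨x, hx⟩ := Function.ne_iff.1 hg
  obtain ⟨y, hy⟩ := hfin.exists_notMem
  -- With `x` in the support and `y` outside it, the difference along `y - x` takes the value `-g x`
  -- at `x`.
  refine ⟨y - x, fun h => ?_, ?_⟩
  · have := congrFun h x
    rw [Function.notMem_support] at hy
    simp [fwdDiff, hy] at this
    exact hx this
  · refine ((hfin.preimage (f := fun z => z + (y - x))
      (add_left_injective _).injOn).union hfin).subset fun z hz => ?_
    by_contra h
    simp only [Set.mem_union, Set.mem_preimage, not_or, Function.notMem_support] at h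
    exact hz (by simp [fwdDiff, h.1, h.2])

theorem exists_foldr_fwdDiff_ne_zero [Infinite A] {g : A → B} (hfin : g.support.Finite)
    (hg : g ≠ 0) (n : ℕ) : ∃ l : List A, l.length = n ∧ l.foldr fwdDiff g ≠ 0 ∧
      (l.foldr fwdDiff g).support.Finite := by
  induction n with
  | zero => exact ⟨[], rfl, hg, hfin⟩
  | succ n ih =>
    obtain ⟨l, hl, h1, h2⟩ := ih
    obtain ⟨a, ha, ha'⟩ := exists_fwdDiff_ne_zero h2 h1
    exact ⟨a :: l, by simp [hl], ha, ha'⟩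

theorem fdeg_deltaFun_of_infinite [Infinite A] (a : A) {b : B} (hb : b ≠ 0) :
    fdeg (deltaFun a b) = ⊤ := by
  have hne : deltaFun a b ≠ 0 := fun h => hb (by
    rw [← deltaFun_self a b, h]; rfl)
  refine fdeg_eq_top hne fun n hn => ?_
  obtain ⟨l, hl, h, -⟩ := exists_foldr_fwdDiff_ne_zero ((Set.finite_singleton a).subset
    fun x hx => by_contra fun hxa => hx (deltaFun_of_ne hxa b)) hne (n + 1)
  exact h (hn l hl)

theorem foldr_replicate_fwdDiff (a : A) (f : A → B) (n : ℕ) :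
    (List.replicate n a).foldr fwdDiff f = (fwdDiff a)^[n] f := by
  induction n with
  | zero => rfl
  | succ n ih => rw [List.replicate_succ, List.foldr_cons, ih, Function.iterate_succ_apply']

theorem add_nsmul_of_fwdDiff_fwdDiff {a : A} {k : A → B} (h : fwdDiff a (fwdDiff a k) = 0)
    (n : ℕ) (x : A) : k (x + n • a) = k x + n • fwdDiff a k x := by
  have hper : ∀ n : ℕ, fwdDiff a k (x + n • a) = fwdDiff a k x := by
    intro n
    induction n with
    | zero => simp
    | succ n ih =>
      rw [succ_nsmul, ← add_assoc, ← ih]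
      exact sub_eq_zero.1 (congrFun h (x + n • a))
  induction n with
  | zero => simp
  | succ n ih =>
    have h1 := hper n
    rw [fwdDiff, sub_eq_iff_eq_add, add_assoc, ← succ_nsmul, ih] at h1
    rw [h1, succ_nsmul]; abel

/-- An iterated difference along an element killed by `m` can only vanish if the first difference
is killed by a power of `m`. -/
theorem pow_smul_fwdDiff_eq_zero {a : A} {m : ℕ} (ha : m • a = 0) (n : ℕ) (f : A → B)
    (h : (fwdDiff a)^[n + 1] f = 0) : m ^ n • fwdDiff a f = 0 := by
  induction n generalizing f with
  | zero => simpa using h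
  | succ n ih =>
    have h1 := ih (fwdDiff a f) (by rwa [← Function.iterate_succ_apply])
    rw [← fwdDiff_const_smul, ← fwdDiff_const_smul] at h1
    funext x
    -- By induction `m ^ n • f` is affine along `a`. Going `m` steps returns to `x`, so `m` kills
    -- its slope.
    have h2 := add_nsmul_of_fwdDiff_fwdDiff h1 m x
    rw [ha, add_zero, left_eq_add, fwdDiff_const_smul] at h2
    rw [pow_succ', mul_smul]
    exact h2

theorem pow_smul_eq_zero_of_degLE {a : A} (ha0 : a ≠ 0) {m : ℕ} (ha : m • a = 0) {b : B} {n : ℕ}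
    (h : DegLE (deltaFun (0 : A) b) n) : m ^ n • b = 0 := by
  have h1 := pow_smul_fwdDiff_eq_zero ha n (deltaFun (0 : A) b) (by
    rw [← foldr_replicate_fwdDiff]
    exact h _ (by simp))
  have h2 := congrFun h1 0
  simp only [Pi.smul_apply, fwdDiff, zero_add, deltaFun_of_ne ha0, deltaFun_self, zero_sub,
    Pi.zero_apply, smul_neg, neg_eq_zero] at h2
  exact h2

end Degree

theorem isPrimary_of_degLE {A B : Type*} [AddCommGroup A] [AddCommGroup B] {q : ℕ} [Finite A]
    (hq : q.Prime) (hdvd : q ∣ Nat.card A)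
    (h : ∀ b : B, ∃ n, DegLE (deltaFun (0 : A) b) n) : IsPrimary q B := by
  have := Fact.mk hq
  obtain ⟨a, ha⟩ := exists_prime_addOrderOf_dvd_card' q hdvd
  have ha0 : a ≠ 0 := fun h0 => hq.one_lt.ne' (by rw [← ha, h0, addOrderOf_zero])
  intro b
  obtain ⟨n, hn⟩ := h b
  exact ⟨n, pow_smul_eq_zero_of_degLE ha0 (ha ▸ addOrderOf_nsmul_eq_zero a) hn⟩

/-- Every prime dividing the order of `A` makes `B` primary for it; two such primes would force `B`
to be trivial. -/
theorem exists_isPrimary_of_degLE {A B : Type*} [AddCommGroup A] [AddCommGroup B] [Nontrivial A]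
    [Nontrivial B] [Finite A] (h : ∀ b : B, ∃ n, DegLE (deltaFun (0 : A) b) n) :
    ∃ p : ℕ, p.Prime ∧ IsPrimary p A ∧ IsPrimary p B := by
  obtain ⟨p, hp, hpd⟩ := Nat.exists_prime_and_dvd (n := Nat.card A) Finite.one_lt_card.ne'
  have hB := isPrimary_of_degLE hp hpd h
  refine ⟨p, hp, ?_, hB⟩
  have huniq : ∀ q : ℕ, q.Prime → q ∣ Nat.card A → q = p := by
    intro q hq hqd
    by_contra hne
    obtain ⟨b, hb⟩ := exists_ne (0 : B)
    obtain ⟨m, hm⟩ := hB b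
    obtain ⟨n, hn⟩ := isPrimary_of_degLE hq hqd h b
    have hcop : Nat.Coprime (p ^ m) (q ^ n) :=
      ((Nat.coprime_primes hp hq).2 (Ne.symm hne)).pow m n
    have h1 := Nat.dvd_gcd (addOrderOf_dvd_of_nsmul_eq_zero hm)
      (addOrderOf_dvd_of_nsmul_eq_zero hn)
    rw [hcop, Nat.dvd_one, AddMonoid.addOrderOf_eq_one_iff] at h1
    exact hb h1
  have hcard := Nat.eq_prime_pow_of_unique_prime_dvd (n := Nat.card A) (p := p)
    Nat.card_pos.ne' (fun {d} hd hd' => huniq d hd hd')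
  intro x
  refine ⟨(Nat.card A).primeFactorsList.length, ?_⟩
  rw [← hcard]
  exact card_nsmul_eq_zero'

/-! ### Differences as elements of the group ring -/

section Action

variable (R A B : Type*) [CommRing R] [AddCommGroup A] [AddCommGroup B] [Module R B]

/-- The action of the group ring on functions by shifts. -/
noncomputable def shiftAction : AddMonoidAlgebra R A →ₐ[R] Module.End R (A → B) :=
  AddMonoidAlgebra.lift R (Module.End R (A → B)) A
    { toFun := fun a =>
        { toFun := fun f x => f (x + a.toAdd)
          map_add' := fun _ _ => rfl
          map_smul' := fun _ _ => rfl }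
      map_one' := by ext; simp
      map_mul' := fun a b => by
        refine LinearMap.ext fun f => funext fun x => ?_
        change f (x + (a.toAdd + b.toAdd)) = f (x + a.toAdd + b.toAdd)
        rw [add_assoc] }

variable {R A B}

theorem shiftAction_single_sub_one (a : A) (f : A → B) :
    shiftAction R A B (AddMonoidAlgebra.single a 1 - 1) f = fwdDiff a f := by
  funext x
  simp [shiftAction, fwdDiff]

theorem foldr_fwdDiff_eq_shiftAction (l : List A) (f : A → B) :
    l.foldr fwdDiff f = shiftAction R A B
      (l.map fun a => (AddMonoidAlgebra.single a 1 - 1 : AddMonoidAlgebra R A)).prod f := by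
  induction l with
  | nil => simp
  | cons a l ih =>
    rw [List.foldr_cons, List.map_cons, List.prod_cons, map_mul, Module.End.mul_apply, ← ih,
      shiftAction_single_sub_one]

theorem single_sub_one_mem_augmentationIdeal (a : A) :
    (AddMonoidAlgebra.single a 1 - 1 : AddMonoidAlgebra R A) ∈ augmentationIdeal R A := by
  rw [augmentationIdeal, RingHom.mem_ker, map_sub, map_one, augmentation_single, sub_self]

theorem list_prod_mem_augmentationIdeal_pow (l : List A) :
    (l.map fun a => (AddMonoidAlgebra.single a 1 - 1 : AddMonoidAlgebra R A)).prod ∈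
      augmentationIdeal R A ^ l.length := by
  induction l with
  | nil => simp
  | cons a l ih =>
    rw [List.map_cons, List.prod_cons, List.length_cons, pow_succ']
    exact Ideal.mul_mem_mul (single_sub_one_mem_augmentationIdeal a) ih

/-- An `(n+1)`-fold difference acts as a multiple of `r`, and `r` kills `f`. -/
theorem degLE_of_augmentationIdeal_pow_le {n : ℕ} {r : R} {f : A → B} (hf : r • f = 0)
    (h : augmentationIdeal R A ^ (n + 1) ≤ Ideal.span {algebraMap R (AddMonoidAlgebra R A) r}) :
    DegLE f n := by
  intro l hl
  rw [foldr_fwdDiff_eq_shiftAction (R := R)]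
  have hmem := h (hl ▸ list_prod_mem_augmentationIdeal_pow (R := R) l)
  obtain ⟨c, hc⟩ := Ideal.mem_span_singleton'.1 hmem
  rw [← hc, map_mul, Module.End.mul_apply, AlgHom.commutes, Module.algebraMap_end_apply, hf,
    map_zero]

/-- The identity `[x+y] - 1 = [x]([y] - 1) + ([x] - 1)` reduces all `[a] - 1` to generators of the
group. -/
theorem augmentationIdeal_eq_span {ι : Type*} {e : ι → A}
    (he : AddSubgroup.closure (Set.range e) = ⊤) :
    augmentationIdeal R A = Ideal.span
      (Set.range fun j => (AddMonoidAlgebra.single (e j) 1 - 1 : AddMonoidAlgebra R A)) := by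
  set J := Ideal.span
      (Set.range fun j => (AddMonoidAlgebra.single (e j) 1 - 1 : AddMonoidAlgebra R A)) with hJ
  have hmul : ∀ a b : A, (AddMonoidAlgebra.single (a + b) 1 : AddMonoidAlgebra R A) =
      AddMonoidAlgebra.single a 1 * AddMonoidAlgebra.single b 1 := fun a b => by
    rw [AddMonoidAlgebra.single_mul_single, mul_one]
  have hall : ∀ a : A, (AddMonoidAlgebra.single a 1 - 1 : AddMonoidAlgebra R A) ∈ J := by
    intro a
    have ha : a ∈ AddSubgroup.closure (Set.range e) := he ▸ AddSubgroup.mem_top a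
    induction ha using AddSubgroup.closure_induction with
    | mem x hx =>
      obtain ⟨j, rfl⟩ := hx
      exact Ideal.subset_span ⟨j, rfl⟩
    | zero => rw [← AddMonoidAlgebra.one_def, sub_self]; exact J.zero_mem
    | add x y _ _ hx hy =>
      have : (AddMonoidAlgebra.single (x + y) 1 - 1 : AddMonoidAlgebra R A) =
          AddMonoidAlgebra.single x 1 * (AddMonoidAlgebra.single y 1 - 1)
            + (AddMonoidAlgebra.single x 1 - 1) := by rw [hmul]; ring
      rw [this]
      exact J.add_mem (J.mul_mem_left _ hy) hx
    | neg x _ hx =>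
      have : (AddMonoidAlgebra.single (-x) 1 - 1 : AddMonoidAlgebra R A) =
          - (AddMonoidAlgebra.single (-x) 1 * (AddMonoidAlgebra.single x 1 - 1)) := by
        rw [mul_sub, ← hmul, neg_add_cancel, ← AddMonoidAlgebra.one_def]; ring
      rw [this]
      exact J.neg_mem (J.mul_mem_left _ hx)
  refine le_antisymm (fun x hx => ?_) ?_
  · have hx' : x - algebraMap R _ (augmentation R A x) ∈ J := by
      clear hx
      induction x using AddMonoidAlgebra.induction_linear with
      | zero => simp
      | add x y hx hy =>
        have := J.add_mem hx hy
        rwa [← add_sub_add_comm, ← map_add, ← map_add] at this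
      | single a r =>
        rw [augmentation_single]
        have : (AddMonoidAlgebra.single a r - algebraMap R _ r : AddMonoidAlgebra R A) =
            algebraMap R _ r * (AddMonoidAlgebra.single a 1 - 1) := by
          rw [mul_sub, mul_one, ← Algebra.smul_def, AddMonoidAlgebra.smul_single, smul_eq_mul,
            mul_one]
        rw [this]
        exact J.mul_mem_left _ (hall a)
    have h0 : augmentation R A x = 0 := hx
    simpa [h0] using hx'
  · rw [hJ, Ideal.span_le]
    rintro _ ⟨j, rfl⟩
    exact single_sub_one_mem_augmentationIdeal _

/-- Powers of the augmentation ideal of a finite abelian `p`-group. -/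
theorem augmentationIdeal_pow_le {ι : Type*} [Fintype ι] {p α : ℕ} (hp : p.Prime) {e : ι → A}
    (he : AddSubgroup.closure (Set.range e) = ⊤) (a : ι → ℕ) (ha : ∀ j, a j ≤ α)
    (hord : ∀ j, p ^ a j • e j = 0) (b : ℕ) :
    augmentationIdeal R A ^ ((∑ j, (p ^ a j - 1)) + b * ((p - 1) * p ^ (α - 1)) + 1) ≤
      Ideal.span {algebraMap R (AddMonoidAlgebra R A) (p ^ (b + 1))} := by
  rw [augmentationIdeal_eq_span he]
  refine (span_sub_one_pow_le hp a ha (fun j => AddMonoidAlgebra.single (e j) 1)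
    (fun j => ?_) b).trans ?_
  · rw [AddMonoidAlgebra.single_pow, hord, one_pow, AddMonoidAlgebra.one_def]
  · rw [Ideal.span_singleton_pow, map_pow, map_natCast]

end Action

end FunctionalDegree

namespace FunctionalDegree

/-! ### Sums of cyclic groups: the exact values -/

theorem exists_list_count {ι : Type*} [Fintype ι] [DecidableEq ι] (n : ι → ℕ) :
    ∃ l : List ι, (∀ j, l.count j = n j) ∧ l.length = ∑ j, n j := by
  refine ⟨(∑ j, n j • ({j} : Multiset ι)).toList, fun j => ?_, ?_⟩
  · rw [← Multiset.coe_count, Multiset.coe_toList, Multiset.count_sum']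
    simp [Multiset.count_singleton]
  · simp

theorem foldr_fwdDiff_comp {A A' B : Type*} [AddCommGroup A] [AddCommGroup A'] [AddCommGroup B]
    (e : A ≃+ A') (g : A' → B) (l : List A') :
    (l.map e.symm).foldr fwdDiff (g ∘ e) = l.foldr fwdDiff g ∘ e := by
  induction l with
  | nil => rfl
  | cons a l ih =>
    rw [List.map_cons, List.foldr_cons, ih]
    funext x
    simp [fwdDiff]

section Product

variable {ι B : Type*} [Fintype ι] [DecidableEq ι] [AddCommGroup B] {G : ι → Type*}
  [∀ j, AddCommGroup (G j)]

/-- The product of functions on the summands of a direct sum, with coefficient `b`. -/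
def prodFun (f : ∀ j, G j → ℤ) (b : B) : DirectSum ι G → B := fun x => (∏ j, f j (x j)) • b

theorem fwdDiff_prodFun (f : ∀ j, G j → ℤ) (b : B) (i : ι) (c : G i) :
    fwdDiff (DirectSum.of G i c) (prodFun f b) =
      prodFun (Function.update f i (fwdDiff c (f i))) b := by
  funext x
  simp only [fwdDiff, prodFun]
  rw [← sub_smul, ← Finset.mul_prod_erase _ _ (Finset.mem_univ i),
    ← Finset.mul_prod_erase (a := i) Finset.univ (fun j => f j (x j)) (Finset.mem_univ i),
    ← Finset.mul_prod_erase (a := i) Finset.univ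
      (fun j => Function.update f i (fwdDiff c (f i)) j (x j)) (Finset.mem_univ i)]
  have h1 : ∏ j ∈ Finset.univ.erase i, f j ((x + DirectSum.of G i c) j) =
      ∏ j ∈ Finset.univ.erase i, f j (x j) := Finset.prod_congr rfl fun j hj => by
    rw [DirectSum.add_apply, DirectSum.of_eq_of_ne _ _ _ (Finset.ne_of_mem_erase hj), add_zero]
  have h2 : ∏ j ∈ Finset.univ.erase i, Function.update f i (fwdDiff c (f i)) j (x j) =
      ∏ j ∈ Finset.univ.erase i, f j (x j) := Finset.prod_congr rfl fun j hj => by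
    rw [Function.update_of_ne (Finset.ne_of_mem_erase hj)]
  rw [h1, h2, ← sub_mul, Function.update_self, DirectSum.add_apply, DirectSum.of_eq_same]
  rfl

theorem foldr_fwdDiff_prodFun (f : ∀ j, G j → ℤ) (b : B) (c : ∀ j, G j) (l : List ι) :
    (l.map fun j => DirectSum.of G j (c j)).foldr fwdDiff (prodFun f b) =
      prodFun (fun j => (fwdDiff (c j))^[l.count j] (f j)) b := by
  induction l with
  | nil => rfl
  | cons i l ih =>
    rw [List.map_cons, List.foldr_cons, ih, fwdDiff_prodFun]
    congr 1
    funext j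
    by_cases h : j = i
    · subst h
      rw [Function.update_self, List.count_cons_self, Function.iterate_succ_apply']
    · rw [Function.update_of_ne h, List.count_cons_of_ne (Ne.symm h)]

end Product

/-- Fewer than `q` steps never return to `0`, so only the unshifted term survives. The value is a
unit, which keeps it harmless as a factor. -/
theorem fwdDiff_iter_deltaFun_zero {q n : ℕ} (hn : n < q) :
    (fwdDiff (1 : ZMod q))^[n] (deltaFun (0 : ZMod q) (1 : ℤ)) 0 = (-1) ^ n := by
  rw [fwdDiff_iter_eq_sum_shift, Finset.sum_eq_single 0]
  · simp [deltaFun]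
  · intro k hk hk0
    have : (0 : ZMod q) + k • 1 ≠ 0 := by
      rw [zero_add, nsmul_one, Ne, ZMod.natCast_eq_zero_iff]
      intro hd
      have := Nat.le_of_dvd (Nat.pos_of_ne_zero hk0) hd
      rw [Finset.mem_range] at hk
      omega
    rw [deltaFun_of_ne this, smul_zero]
  · simp

section CyclicSum

variable {A B : Type*} [AddCommGroup A] [AddCommGroup B] {p r : ℕ} {α : Fin (r + 1) → ℕ}

theorem closure_range_of_one {ι : Type*} [DecidableEq ι] {q : ι → ℕ}
    (e : A ≃+ DirectSum ι fun i => ZMod (q i)) :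
    AddSubgroup.closure (Set.range fun j =>
      e.symm (DirectSum.of (fun i => ZMod (q i)) j 1)) = ⊤ := by
  rw [eq_top_iff]
  intro a _
  rw [← e.symm_apply_apply a]
  induction e a using DirectSum.induction_on with
  | zero => rw [map_zero]; exact AddSubgroup.zero_mem _
  | of j z =>
    obtain ⟨n, rfl⟩ := ZMod.intCast_surjective z
    rw [← zsmul_one n, map_zsmul, map_zsmul]
    exact AddSubgroup.zsmul_mem _ (AddSubgroup.subset_closure (Set.mem_range_self j)) n
  | add x y hx hy => rw [map_add]; exact AddSubgroup.add_mem _ hx hy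

theorem pow_smul_of_one {ι : Type*} [DecidableEq ι] {q : ι → ℕ}
    (e : A ≃+ DirectSum ι fun i => ZMod (q i)) (j : ι) :
    q j • e.symm (DirectSum.of (fun i => ZMod (q i)) j 1) = 0 := by
  rw [← map_nsmul, ← map_nsmul, nsmul_one, ZMod.natCast_self, map_zero, map_zero]

/-- The hypotheses on `b` say that its order is exactly `p ^ (β + 1)`; thus `β` here is one less
than the exponent in the formula. -/
theorem exists_foldr_fwdDiff_ne_zero_of_equiv (hp : p.Prime) (hα : α 0 ≠ 0)
    (e : A ≃+ DirectSum (Fin (r + 1)) fun i => ZMod (p ^ α i)) {b : B} {β : ℕ}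
    (hb : p ^ β • b ≠ 0) (hb' : p ^ (β + 1) • b = 0) :
    ∃ (f : A → B) (l : List A),
      l.length = (∑ j, (p ^ α j - 1)) + β * ((p - 1) * p ^ (α 0 - 1)) ∧
      l.foldr fwdDiff f ≠ 0 := by
  have := Fact.mk hp
  set w := (p - 1) * p ^ (α 0 - 1) with hw
  obtain ⟨y, hy⟩ : ∃ y : ZMod (p ^ α 0), ¬ ((p : ℤ) ^ (β + 1) ∣
      (fwdDiff (1 : ZMod (p ^ α 0)))^[p ^ α 0 - 1 + β * w]
        (deltaFun (0 : ZMod (p ^ α 0)) (1 : ℤ)) y) := by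
    rw [hw]
    obtain ⟨a, ha⟩ := Nat.exists_eq_succ_of_ne_zero hα
    rw [ha]
    exact exists_not_dvd_fwdDiff_iter hp β
  obtain ⟨l, hl, hlen⟩ := exists_list_count
    -- All the extra differences are spent on summand `0`, the one whose `α` enters `w`.
    (fun j : Fin (r + 1) => p ^ α j - 1 + if j = 0 then β * w else 0)
  refine ⟨prodFun (fun j => deltaFun (0 : ZMod (p ^ α j)) (1 : ℤ)) b ∘ e,
    (l.map fun j => DirectSum.of (fun i => ZMod (p ^ α i)) j 1).map e.symm, ?_, ?_⟩
  · rw [List.length_map, List.length_map, hlen, Finset.sum_add_distrib]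
    simp
  · rw [foldr_fwdDiff_comp, foldr_fwdDiff_prodFun]
    intro h
    -- At this point the other factors are units, and the factor at `0` is not divisible by the
    -- order of `b`.
    have h1 := congrFun h (e.symm (DirectSum.of (fun i => ZMod (p ^ α i)) 0 y))
    simp only [Function.comp_apply, AddEquiv.apply_symm_apply, prodFun, Pi.zero_apply, hl] at h1
    rw [← addOrderOf_dvd_iff_zsmul_eq_zero, addOrderOf_eq_prime_pow hb hb',
      Fin.prod_univ_succ] at h1
    simp only [DirectSum.of_eq_same, if_true, Fin.succ_ne_zero, if_false, add_zero] at h1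
    have hunit : IsUnit (∏ i : Fin r, (fwdDiff (1 : ZMod (p ^ α i.succ)))^[p ^ α i.succ - 1]
        (deltaFun (0 : ZMod (p ^ α i.succ)) (1 : ℤ))
        (DirectSum.of (fun i => ZMod (p ^ α i)) 0 y i.succ)) := by
      rw [IsUnit.prod_univ_iff]
      intro i
      rw [DirectSum.of_eq_of_ne _ _ _ (Fin.succ_ne_zero i), fwdDiff_iter_deltaFun_zero]
      · exact (isUnit_one.neg).pow _
      · have : 0 < p ^ α i.succ := pow_pos hp.pos _
        omega
    rw [hunit.dvd_mul_right] at h1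
    exact hy (by exact_mod_cast h1)

theorem alpha_zero_ne_zero [Nontrivial A] (hα : Antitone α)
    (e : A ≃+ DirectSum (Fin (r + 1)) fun i => ZMod (p ^ α i)) : α 0 ≠ 0 := by
  intro h0
  obtain ⟨x, hx⟩ := exists_ne (0 : A)
  refine hx (e.injective ?_)
  rw [map_zero]
  ext j
  have hj : α j = 0 := Nat.le_zero.1 (h0 ▸ hα (Fin.zero_le j))
  have : Subsingleton (ZMod (p ^ α j)) := by rw [hj, pow_zero]; infer_instance
  exact Subsingleton.elim _ _

theorem delta_eq_of_equiv (hp : p.Prime) (hα : Antitone α) (hα0 : α 0 ≠ 0)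
    (e : A ≃+ DirectSum (Fin (r + 1)) fun i => ZMod (p ^ α i)) {β : ℕ}
    (hB : AddMonoid.exponent B = p ^ (β + 1)) :
    delta A B = (((∑ j, (p ^ α j - 1)) + β * ((p - 1) * p ^ (α 0 - 1)) : ℕ) : WithBot ℕ∞) := by
  refine le_antisymm (iSup_le fun f => fdeg_le_of_degLE ?_) ?_
  · refine degLE_of_augmentationIdeal_pow_le (R := ℤ) (r := p ^ (β + 1)) ?_
      (augmentationIdeal_pow_le hp (closure_range_of_one e) α (fun j => hα (Fin.zero_le j))
        (pow_smul_of_one e) β)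
    funext x
    have := AddMonoid.exponent_nsmul_eq_zero (f x)
    rw [hB] at this
    rw [Pi.smul_apply, Pi.zero_apply, ← this]
    exact_mod_cast natCast_zsmul (f x) (p ^ (β + 1))
  · obtain ⟨b, hb⟩ : ∃ b : B, p ^ β • b ≠ 0 := by
      by_contra! h
      have := AddMonoid.exponent_dvd_of_forall_nsmul_eq_zero h
      rw [hB, Nat.pow_dvd_pow_iff_le_right hp.one_lt] at this
      omega
    obtain ⟨f, l, hl, hne⟩ := exists_foldr_fwdDiff_ne_zero_of_equiv hp hα0 e hb
      (hB ▸ AddMonoid.exponent_nsmul_eq_zero b)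
    rw [← hl]
    exact (length_le_fdeg hne).trans (le_iSup (fun f : A → B => fdeg f) f)

theorem nilpotencyIndex_eq {R : Type*} [CommRing R] {I : Ideal R} {n : ℕ} (h : I ^ (n + 1) = ⊥)
    (h' : I ^ n ≠ ⊥) : nilpotencyIndex I = ((n + 1 : ℕ) : ℕ∞) := by
  refine le_antisymm (iInf₂_le (n + 1) h) (le_iInf₂ fun m hm => ?_)
  rw [Nat.cast_le]
  by_contra! hlt
  exact h' (le_bot_iff.1 (hm ▸ Ideal.pow_le_pow_right (by omega)))

theorem nilpotencyIndex_augmentationIdeal_eq_of_equiv (hp : p.Prime) (hα : Antitone α)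
    (hα0 : α 0 ≠ 0) (e : A ≃+ DirectSum (Fin (r + 1)) fun i => ZMod (p ^ α i)) (β : ℕ) :
    nilpotencyIndex (augmentationIdeal (ZMod (p ^ (β + 1))) A) =
      (((∑ j, (p ^ α j - 1)) + β * ((p - 1) * p ^ (α 0 - 1)) + 1 : ℕ) : ℕ∞) := by
  have h0 : ((p : ZMod (p ^ (β + 1))) ^ (β + 1)) = 0 := by
    exact_mod_cast ZMod.natCast_self (p ^ (β + 1))
  refine nilpotencyIndex_eq ?_ fun h => ?_
  · have := augmentationIdeal_pow_le (R := ZMod (p ^ (β + 1))) hp (closure_range_of_one e) α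
      (fun j => hα (Fin.zero_le j)) (pow_smul_of_one e) β
    rwa [h0, map_zero, Ideal.span_singleton_eq_bot.2 rfl, le_bot_iff] at this
  · have hb : p ^ β • (1 : ZMod (p ^ (β + 1))) ≠ 0 := by
      rw [nsmul_one, Ne, ZMod.natCast_eq_zero_iff, Nat.pow_dvd_pow_iff_le_right hp.one_lt]
      omega
    -- The coefficient ring itself serves as target, with `b = 1`.
    obtain ⟨f, l, hl, hne⟩ := exists_foldr_fwdDiff_ne_zero_of_equiv hp hα0 e hb
      (by rw [nsmul_one, ZMod.natCast_self])
    refine hne ?_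
    rw [foldr_fwdDiff_eq_shiftAction (R := ZMod (p ^ (β + 1)))]
    have hmem := list_prod_mem_augmentationIdeal_pow (R := ZMod (p ^ (β + 1))) l
    rw [hl, h, Ideal.mem_bot] at hmem
    rw [hmem, map_zero, LinearMap.zero_apply]

end CyclicSum

/-! ### Finite `p`-groups and unbounded exponent -/

theorem exists_forall_pow_smul_eq_zero {ι B : Type*} [Finite ι] [AddCommGroup B] {p : ℕ}
    (hB : IsPrimary p B) (f : ι → B) :
    ∃ k, ∀ x, p ^ k • f x = 0 := by
  have := Fintype.ofFinite ι
  choose k hk using fun x => hB (f x)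
  refine ⟨Finset.univ.sup k, fun x => ?_⟩
  obtain ⟨d, hd⟩ := Nat.exists_eq_add_of_le (Finset.le_sup (f := k) (Finset.mem_univ x))
  rw [hd, pow_add, mul_comm, mul_smul, hk, smul_zero]

section Finite

variable {A B : Type*} [AddCommGroup A] [AddCommGroup B] {p : ℕ} [Finite A]

theorem exists_degLE (hp : p.Prime) (hA : IsPrimary p A) (hB : IsPrimary p B) (f : A → B) :
    ∃ n, DegLE f n := by
  have := Fintype.ofFinite A
  obtain ⟨a, ha⟩ := exists_forall_pow_smul_eq_zero hA (id : A → A)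
  obtain ⟨k, hk⟩ := exists_forall_pow_smul_eq_zero hB f
  -- For mere finiteness, all elements of `A` serve as generators and no cyclic decomposition is
  -- needed.
  refine ⟨_, degLE_of_augmentationIdeal_pow_le (R := ℤ) (r := p ^ (k + 1)) ?_
    (augmentationIdeal_pow_le hp (e := (id : A → A)) (by simp) (fun _ => a)
      (fun _ => le_rfl) ha k)⟩
  funext x
  rw [Pi.smul_apply, pow_succ', mul_smul]
  have : (p : ℤ) ^ k • f x = 0 := by
    rw [← hk x]; exact_mod_cast natCast_zsmul (f x) (p ^ k)
  rw [this, smul_zero]; rfl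

theorem delta_eq_top_of_exponent_eq_zero [Nontrivial A] (hp : p.Prime) (hA : IsPrimary p A)
    (hexp : AddMonoid.exponent B = 0) : delta A B = ⊤ := by
  obtain ⟨a, ha⟩ := exists_forall_pow_smul_eq_zero hA (id : A → A)
  obtain ⟨x, hx⟩ := exists_ne (0 : A)
  refine eq_top_of_forall_natCast_le fun n => ?_
  -- Degree at most `n` for the delta function with value `b` would make `(p ^ a) ^ n` kill `b`.
  obtain ⟨b, hb⟩ := AddMonoid.exponent_eq_zero_iff_forall.1 hexp ((p ^ a) ^ n)
    (pow_pos (pow_pos hp.pos _) _)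
  have hn : ¬ DegLE (deltaFun (0 : A) b) n := fun h => hb (pow_smul_eq_zero_of_degLE hx (ha x) h)
  simp only [DegLE, not_forall] at hn
  obtain ⟨l, hl, hne⟩ := hn
  refine le_trans ?_ ((length_le_fdeg hne).trans (le_iSup (fun f : A → B => fdeg f) _))
  rw [hl]
  exact_mod_cast Nat.le_succ n

end Finite

end FunctionalDegree

/-- In the formula of the third part, all natural number subtractions are genuine: nontriviality of
`A` forces `α 0 ≥ 1`, and nontriviality of `B` forces `β ≥ 1`. -/
theorem theorem3p8 {A : Type*} {B : Type*} [AddCommGroup A] [AddCommGroup B]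
    [Nontrivial A] [Nontrivial B] :
    (Infinite A →
      (∀ (a : A) (b : B), b ≠ 0 →
        FunctionalDegree.fdeg (FunctionalDegree.deltaFun a b) = ⊤) ∧
      FunctionalDegree.delta A B = ⊤) ∧
    ((¬ ∃ p : ℕ, p.Prime ∧ Finite A ∧ FunctionalDegree.IsPrimary p A ∧
        FunctionalDegree.IsPrimary p B) →
      (∃ b : B, FunctionalDegree.fdeg (FunctionalDegree.deltaFun (0 : A) b) = ⊤) ∧
      FunctionalDegree.delta A B = ⊤) ∧
    (∀ (p r β : ℕ) (α : Fin (r + 1) → ℕ), p.Prime → Antitone α →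
      Nonempty (A ≃+ DirectSum (Fin (r + 1)) (fun i => ZMod (p ^ α i))) →
      AddMonoid.exponent B = p ^ β →
      FunctionalDegree.delta A B =
        (((∑ j, (p ^ α j - 1)) + (β - 1) * (p - 1) * p ^ (α 0 - 1) : ℕ) : WithBot ℕ∞) ∧
      FunctionalDegree.nilpotencyIndex (FunctionalDegree.augmentationIdeal (ZMod (p ^ β)) A) =
        (((∑ j, (p ^ α j - 1)) + (β - 1) * (p - 1) * p ^ (α 0 - 1) + 1 : ℕ) : ℕ∞)) ∧
    (∀ p : ℕ, p.Prime → Finite A → FunctionalDegree.IsPrimary p A →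
      FunctionalDegree.IsPrimary p B → AddMonoid.exponent B = 0 →
      (∀ f : A → B, FunctionalDegree.fdeg f < ⊤) ∧ FunctionalDegree.delta A B = ⊤) := by
  open FunctionalDegree in
  refine ⟨fun hA => ?_, fun h => ?_, ?_, ?_⟩
  · obtain ⟨b, hb⟩ := exists_ne (0 : B)
    exact ⟨fun a b hb => fdeg_deltaFun_of_infinite a hb,
      delta_eq_top (fdeg_deltaFun_of_infinite (0 : A) hb)⟩
  · suffices hex : ∃ b : B, fdeg (deltaFun (0 : A) b) = ⊤ from ⟨hex, delta_eq_top hex.choose_spec⟩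
    cases finite_or_infinite A with
    | inr hA =>
      obtain ⟨b, hb⟩ := exists_ne (0 : B)
      exact ⟨b, fdeg_deltaFun_of_infinite (0 : A) hb⟩
    | inl hA =>
      by_contra! hne
      refine h ?_
      obtain ⟨p, hp, hpA, hpB⟩ := exists_isPrimary_of_degLE (A := A) (B := B) (fun b => by
        by_contra! hb
        -- The zero function has degree `⊥`, not `⊤`; it is excluded because it satisfies `DegLE` at
        -- `0`.
        refine hne b (fdeg_eq_top (fun h0 => hb 0 ?_) hb)
        rintro (_ | ⟨a, _ | ⟨a', l⟩⟩) hl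
        · simp at hl
        · rw [h0]; exact fwdDiff_zero_fun a
        · simp at hl)
      exact ⟨p, hp, hA, hpA, hpB⟩
  · rintro p r β α hp hα ⟨e⟩ hB
    have hα0 := alpha_zero_ne_zero hα e
    obtain ⟨β, rfl⟩ : ∃ β', β = β' + 1 := by
      refine Nat.exists_eq_succ_of_ne_zero fun h0 => ?_
      rw [h0, pow_zero, AddMonoid.exp_eq_one_iff] at hB
      exact not_subsingleton B hB
    rw [Nat.add_sub_cancel, mul_assoc]
    exact ⟨delta_eq_of_equiv hp hα hα0 e hB,
      nilpotencyIndex_augmentationIdeal_eq_of_equiv hp hα hα0 e β⟩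
  · intro p hp hA hpA hpB hexp
    refine ⟨fun f => ?_, delta_eq_top_of_exponent_eq_zero hp hpA hexp⟩
    obtain ⟨n, hn⟩ := exists_degLE hp hpA hpB f
    exact fdeg_lt_top_of_degLE hn
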